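/- Let $[n]=\{1,\dots,n\}$. A set $X$ of 3-element subsets of $[n]$ is \emph{closed} if, for every $a\in[n]$ and all $i<j<k$ in $[n]\setminus\{a\}$, $\{a,i,j\}\in X$ and $\{a,j,k\}\in X$ imply $\{a,i,k\}\in X$; it is \emph{consistent} if both $X$ and $\binom{[n]}{3}\setminus X$ are closed. Let $B(n,2)$ be the set of consistent sets, and let $\overline{X}$ denote the smallest closed set containing $X$. A \emph{wiring diagram} consists of continuous piecewise linear curves (wires) $C_1,\dots,C_n$ in $\mathbb{R}^2$, each projecting bijectively onto the first coordinate, such that sufficiently far to the right the wires are in the order $C_1,\dots,C_n$ from top to bottom, any two distinct wires meet in exactly one point, and all crossings are transverse. It is \emph{simple} if no three wires have a common point. Let $W$ be a simple wiring diagram. For $i<j<k$, the triple $\{i,j,k\}$ is an \emph{inversion triple} if the crossing of $C_i$ and $C_k$ is below $C_j$, and a \emph{non-inversion triple} if it is above $C_j$; the \emph{inversion set} of $W$ is the set of its inversion triples. The \emph{floor} of a non-inversion triple $\{i,j,k\}$, $i<j<k$, is the segment of $C_j$ between $C_i\cap C_j$ and $C_k\cap C_j$; it is \emph{elementary} if its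 interior (the segment without its end points) is not met by any wire other than $C_j$; the \emph{height} of the triple is the number of wires that pass below its floor. A \emph{block} is a nonempty set of non-inversion triples of the form $\mathcal{I}=\{\{i_j,i_{j+1},i_{j+2}\}: 1\le j\le m\}$ with $m\ge 1$ and $1\le i_1<\cdots<i_{m+2}\le n$. It has an \emph{elementary floor} if the floors of all its elements are elementary; in that case all its elements have the same height, which is called the height of $\mathcal{I}$. \textbf{Proposition.} Let $W$ be a simple wiring diagram with inversion set $X$, and let $Y\in B(n,2)$ with $X\subseteq Y$. Let $\mathcal{I}\subseteq Y\setminus X$ be a block with an elementary floor in $W$ whose height is maximum among all blocks contained in $Y\setminus X$ that have an elementary floor in $W$. Then $X\cup\overline{\mathcal{I}}$ is consistent. -/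

import Mathlib

open Set Filter Topology

namespace HigherBruhat

/-- The family of all `(d + 1)`-element subsets of the ground set. The ground set `{1, …, n}` is
modelled by `Fin n` with its linear order. -/
def levelSets (n d : ℕ) : Set (Finset (Fin n)) := {I | I.card = d + 1}

/-- A family `X` of `(d + 1)`-element subsets is closed if for every `(d - 1)`-element set `I` and
all `i < j < k` outside `I`, `I ∪ {i, j} ∈ X` and `I ∪ {j, k} ∈ X` imply `I ∪ {i, k} ∈ X`. -/
def IsClosedFamily {n : ℕ} (d : ℕ) (X : Set (Finset (Fin n))) : Prop :=
  X ⊆ levelSets n d ∧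
    ∀ (I : Finset (Fin n)) (i j k : Fin n), I.card + 1 = d → i ∉ I → j ∉ I → k ∉ I →
      i < j → j < k → I ∪ {i, j} ∈ X → I ∪ {j, k} ∈ X → I ∪ {i, k} ∈ X

/-- A family of `(d + 1)`-element subsets is consistent if it and its complement among all
`(d + 1)`-element subsets are closed. -/
def IsConsistent {n : ℕ} (d : ℕ) (X : Set (Finset (Fin n))) : Prop :=
  IsClosedFamily d X ∧ IsClosedFamily d (levelSets n d \ X)

/-- The underlying set of the higher Bruhat order `B(n, d)`: all consistent families. -/
def B (n d : ℕ) : Set (Set (Finset (Fin n))) := {X | IsConsistent d X}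

/-- The closure of a family: the intersection of all closed families containing it. -/
def closureFamily {n : ℕ} (d : ℕ) (X : Set (Finset (Fin n))) : Set (Finset (Fin n)) :=
  ⋂₀ {Z | IsClosedFamily d Z ∧ X ⊆ Z}

theorem isClosedFamily_levelSets (n d : ℕ) : IsClosedFamily d (levelSets n d) := by
  refine ⟨subset_rfl, ?_⟩
  intro I i j k hI hi hj hk hij hjk _ _
  have hik : i ≠ k := (hij.trans hjk).ne
  have hdisj : Disjoint I {i, k} := by
    simp [hi, hk]
  change (I ∪ {i, k}).card = d + 1
  rw [Finset.card_union_of_disjoint hdisj, Finset.card_pair hik]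
  omega

/-- The closure of a family of `(d + 1)`-element subsets is the smallest closed family
containing it. -/
theorem isLeast_closureFamily {n d : ℕ} {X : Set (Finset (Fin n))} (hX : X ⊆ levelSets n d) :
    IsLeast {Z | IsClosedFamily d Z ∧ X ⊆ Z} (closureFamily d X) := by
  refine ⟨⟨⟨?_, ?_⟩, ?_⟩, ?_⟩
  · exact sInter_subset_of_mem ⟨isClosedFamily_levelSets n d, hX⟩
  · intro I i j k hI hi hj hk hij hjk h1 h2 Z hZ
    exact hZ.1.2 I i j k hI hi hj hk hij hjk (h1 Z hZ) (h2 Z hZ)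
  · exact subset_sInter fun Z hZ => hZ.2
  · exact fun Z hZ => sInter_subset_of_mem hZ

/-- A function on the line is piecewise linear if on every compact interval there are finitely many
break points such that it is affine on every subinterval with no break point in its interior. -/
def IsPiecewiseLinear (f : ℝ → ℝ) : Prop :=
  ∀ a b : ℝ, ∃ S : Finset ℝ, ∀ x y : ℝ, a ≤ x → x ≤ y → y ≤ b → Disjoint (Ioo x y) (S : Set ℝ) →
    ∃ m c : ℝ, ∀ t ∈ Icc x y, f t = m * t + c

/-- A wiring diagram with `n` wires. A continuous curve in the plane that projects bijectively onto
the first coordinate is the graph of a continuous function, and `wire i` is the function whose graph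
is the `i`-th wire. -/
structure WiringDiagram (n : ℕ) where
  /-- The function whose graph is the `i`-th wire. -/
  wire : Fin n → ℝ → ℝ
  continuous_wire : ∀ i, Continuous (wire i)
  piecewiseLinear_wire : ∀ i, IsPiecewiseLinear (wire i)
  /-- Sufficiently far to the right the wires are in order from top to bottom. -/
  order_right : ∀ᶠ x in atTop, ∀ i j : Fin n, i < j → wire j x < wire i x
  /-- Two distinct wires meet in exactly one point. -/
  existsUnique_crossing : ∀ i j : Fin n, i ≠ j → ∃! x : ℝ, wire i x = wire j x
  /-- At a common point two distinct wires pass from one side of each other to the other side. -/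
  transverse : ∀ i j : Fin n, i ≠ j → ∀ x : ℝ, wire i x = wire j x →
    ((∀ᶠ y in 𝓝[<] x, wire i y < wire j y) ∧ (∀ᶠ y in 𝓝[>] x, wire j y < wire i y)) ∨
    ((∀ᶠ y in 𝓝[<] x, wire j y < wire i y) ∧ (∀ᶠ y in 𝓝[>] x, wire i y < wire j y))

namespace WiringDiagram

variable {n : ℕ}

/-- A wiring diagram is simple if no three distinct wires have a common point. -/
def IsSimple (W : WiringDiagram n) : Prop :=
  ∀ i j k : Fin n, i ≠ j → j ≠ k → i ≠ k → ∀ x : ℝ, ¬ (W.wire i x = W.wire j x ∧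
    W.wire j x = W.wire k x)

open Classical in
/-- The first coordinate of the crossing of the wires `i` and `j`, for `i ≠ j`
(and `0` if `i = j`). -/
noncomputable def cross (W : WiringDiagram n) (i j : Fin n) : ℝ :=
  if h : i ≠ j then (W.existsUnique_crossing i j h).choose else 0

theorem wire_cross (W : WiringDiagram n) {i j : Fin n} (h : i ≠ j) :
    W.wire i (W.cross i j) = W.wire j (W.cross i j) := by
  rw [cross, dif_pos h]
  exact (W.existsUnique_crossing i j h).choose_spec.1

/-- `{i, j, k}` with `i < j < k` is an inversion triple if the crossing of the wires `i` and `k` is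
below the wire `j`. -/
def IsInversionTriple (W : WiringDiagram n) (T : Finset (Fin n)) : Prop :=
  ∃ i j k : Fin n, i < j ∧ j < k ∧ T = {i, j, k} ∧
    W.wire i (W.cross i k) < W.wire j (W.cross i k)

/-- `{i, j, k}` with `i < j < k` is a non-inversion triple if the crossing of the wires `i` and `k`
is above the wire `j`. -/
def IsNonInversionTriple (W : WiringDiagram n) (T : Finset (Fin n)) : Prop :=
  ∃ i j k : Fin n, i < j ∧ j < k ∧ T = {i, j, k} ∧
    W.wire j (W.cross i k) < W.wire i (W.cross i k)

/-- The set of inversion triples. -/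
def inversionSet (W : WiringDiagram n) : Set (Finset (Fin n)) := {T | W.IsInversionTriple T}

/-- A block: a nonempty set of non-inversion triples that consists of the triples of consecutive
elements of a sequence `a 0 < a 1 < ⋯ < a (m + 1)`. -/
def IsBlock (W : WiringDiagram n) (𝓘 : Set (Finset (Fin n))) : Prop :=
  ∃ (m : ℕ) (a : Fin (m + 2) → Fin n), 1 ≤ m ∧ StrictMono a ∧
    𝓘 = Set.range (fun j : Fin m =>
      ({a j.castSucc.castSucc, a j.succ.castSucc, a j.succ.succ} : Finset (Fin n))) ∧
    ∀ T ∈ 𝓘, W.IsNonInversionTriple T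

/-- The segment of the wire `j` between its crossings with the wires `i` and `k`. -/
def segment (W : WiringDiagram n) (i j k : Fin n) : Set (ℝ × ℝ) :=
  (fun x => (x, W.wire j x)) '' uIcc (W.cross i j) (W.cross k j)

/-- The interior of a segment: the segment without its two end points. -/
def segmentInterior (W : WiringDiagram n) (i j k : Fin n) : Set (ℝ × ℝ) :=
  (fun x => (x, W.wire j x)) '' uIoo (W.cross i j) (W.cross k j)

/-- The floor of the triple `{i, j, k}`, `i < j < k`: the segment of the wire `j` between its
crossings with the wires `i` and `k`. -/
def floor (W : WiringDiagram n) (T : Finset (Fin n)) : Set (ℝ × ℝ) :=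
  {q | ∃ i j k : Fin n, i < j ∧ j < k ∧ T = {i, j, k} ∧ q ∈ W.segment i j k}

/-- The floor of a triple is elementary if no wire other than the one it lies on meets its
interior. -/
def HasElementaryFloor (W : WiringDiagram n) (T : Finset (Fin n)) : Prop :=
  ∀ i j k : Fin n, i < j → j < k → T = {i, j, k} →
    ∀ q ∈ W.segmentInterior i j k, ∀ p : Fin n, p ≠ j → W.wire p q.1 ≠ q.2

/-- The floor of a block is the union of the floors of its elements. It is elementary if none of
these segments is met in its interior by a wire other than the one it lies on. (Consecutive segments
share an end point, which is the crossing of the two wires supporting them.) -/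
def HasElementaryBlockFloor (W : WiringDiagram n) (𝓘 : Set (Finset (Fin n))) : Prop :=
  ∀ T ∈ 𝓘, W.HasElementaryFloor T

/-- The height of a triple: the number of wires that pass below its floor. -/
noncomputable def height (W : WiringDiagram n) (T : Finset (Fin n)) : ℕ :=
  {p : Fin n | ∀ q ∈ W.floor T, W.wire p q.1 < q.2}.ncard

/-- The height of a block with an elementary floor is the common height of its elements; it is
written here as the largest of their heights. -/
noncomputable def blockHeight (W : WiringDiagram n) (𝓘 : Set (Finset (Fin n))) : ℕ :=
  sSup (W.height '' 𝓘)

end WiringDiagram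

end HigherBruhat

/-! A block with an elementary floor comes from wires `s 0, …, s (m + 1)`. All their triples are
non-inversions, since the complement of the inversion set is closed, so their consecutive crossings
are the vertices of their lower envelope. The closure of the block is the family of all triples of
these wires (`closureFamily_consecutive`).

Elementary floors force every other wire to pass above all vertices or below all of them
(`IsChain.isAbove_or_isBelow`). A wire below is in inversion with exactly the chain pairs that do
not have it in between. If each wire above is in inversion with exactly the pairs that do, adding
the closure preserves consistency (`IsChain.isConsistent_union`).

The only obstruction is a wire `x` above the chain with `s p < x < s q` and `{s p, x, s q}` not an
inversion. For such a pair with `q - p` minimal, take the lower envelope of `s p`, `s q` and all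
such wires. Every triple of `s p`, `s q` and one of them lies in `Y`, so, the complement of `Y`
being closed, some triple of consecutive envelope wires lies in `Y`
(`IsSimple.exists_envelope_triple`). Minimality makes its floor elementary, and it is higher than
every floor of the chain (`IsChain.exists_higher_triple`). As a one-element block it contradicts the
maximality of the height. -/

namespace HigherBruhat

/-! ### Closed families of triples and closures of consecutive triples -/

/-- A closed family of triples, with the packet condition spelled out for one removed element. -/
theorem isClosedFamily_two_iff {n : ℕ} {Z : Set (Finset (Fin n))} :
    IsClosedFamily 2 Z ↔ Z ⊆ levelSets n 2 ∧ ∀ a i j k : Fin n, a ≠ i → a ≠ j → a ≠ k →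
      i < j → j < k → {a, i, j} ∈ Z → {a, j, k} ∈ Z → {a, i, k} ∈ Z := by
  refine and_congr_right fun _ => ⟨fun h a i j k hi hj hk hij hjk h1 h2 => ?_, ?_⟩
  · have := h {a} i j k (by simp) (by simpa using hi.symm) (by simpa using hj.symm)
      (by simpa using hk.symm) hij hjk
    simp only [Finset.singleton_union] at this
    exact this h1 h2
  · intro h I i j k hI hi hj hk hij hjk
    obtain ⟨a, rfl⟩ := Finset.card_eq_one.1 (show I.card = 1 by omega)
    simp only [Finset.mem_singleton] at hi hj hk
    simp only [Finset.singleton_union]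
    exact h a i j k (Ne.symm hi) (Ne.symm hj) (Ne.symm hk) hij hjk

theorem triple_rotate {n : ℕ} (a b c : Fin n) : ({a, b, c} : Finset (Fin n)) = {b, c, a} := by
  ext x; simp only [Finset.mem_insert, Finset.mem_singleton]; tauto

theorem triple_swap {n : ℕ} (a b c : Fin n) : ({a, b, c} : Finset (Fin n)) = {b, a, c} := by
  ext x; simp only [Finset.mem_insert, Finset.mem_singleton]; tauto

theorem triple_mem_levelSets {n : ℕ} {a b c : Fin n} (hab : a ≠ b) (hac : a ≠ c) (hbc : b ≠ c) :
    ({a, b, c} : Finset (Fin n)) ∈ levelSets n 2 :=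
  Finset.card_eq_three.2 ⟨a, b, c, hab, hac, hbc, rfl⟩

/-- The increasing enumeration of a triple is unique. -/
theorem triple_eq_iff {n : ℕ} {i j k u v w : Fin n} (hij : i < j) (hjk : j < k) (huv : u < v)
    (hvw : v < w) (h : ({i, j, k} : Finset (Fin n)) = {u, v, w}) : i = u ∧ j = v ∧ k = w := by
  have h1 : ∀ x, (x = i ∨ x = j ∨ x = k) ↔ (x = u ∨ x = v ∨ x = w) := fun x => by
    simpa using Finset.ext_iff.1 h x
  have hi := (h1 i).1 (by simp)
  have hj := (h1 j).1 (by simp)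
  have hk := (h1 k).1 (by simp)
  have hu := (h1 u).2 (by simp)
  have hv := (h1 v).2 (by simp)
  have hw := (h1 w).2 (by simp)
  omega

namespace IsClosedFamily

variable {n : ℕ} {Z : Set (Finset (Fin n))} {p q r s : Fin n}

/-- The triples of `p < q < r < s` are numbered lexicographically: `pqr`, `pqs`, `prs`, `qrs`. This
lemma and the next three are closedness with common element `p`, `s`, `q`, `r` respectively. -/
theorem mem_second_of_first_third (hZ : IsClosedFamily 2 Z) (hpq : p < q) (hqr : q < r)
    (hrs : r < s) (h1 : {p, q, r} ∈ Z) (h3 : {p, r, s} ∈ Z) : {p, q, s} ∈ Z :=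
  (isClosedFamily_two_iff.1 hZ).2 p q r s (by omega) (by omega) (by omega) hqr hrs h1 h3

theorem mem_third_of_second_fourth (hZ : IsClosedFamily 2 Z) (hpq : p < q) (hqr : q < r)
    (hrs : r < s) (h2 : {p, q, s} ∈ Z) (h4 : {q, r, s} ∈ Z) : {p, r, s} ∈ Z := by
  have := (isClosedFamily_two_iff.1 hZ).2 s p q r (by omega) (by omega) (by omega) hpq hqr
    (by rwa [triple_rotate]) (by rwa [triple_rotate])
  rwa [triple_rotate] at this

theorem mem_second_of_first_fourth (hZ : IsClosedFamily 2 Z) (hpq : p < q) (hqr : q < r)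
    (hrs : r < s) (h1 : {p, q, r} ∈ Z) (h4 : {q, r, s} ∈ Z) : {p, q, s} ∈ Z := by
  have := (isClosedFamily_two_iff.1 hZ).2 q p r s (by omega) (by omega) (by omega)
    (hpq.trans hqr) hrs (by rwa [triple_swap]) h4
  rwa [triple_swap] at this

theorem mem_third_of_first_fourth (hZ : IsClosedFamily 2 Z) (hpq : p < q) (hqr : q < r)
    (hrs : r < s) (h1 : {p, q, r} ∈ Z) (h4 : {q, r, s} ∈ Z) : {p, r, s} ∈ Z := by
  have := (isClosedFamily_two_iff.1 hZ).2 r p q s (by omega) (by omega) (by omega)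
    hpq (hqr.trans hrs) (by rwa [triple_rotate]) (by rwa [triple_swap])
  rwa [triple_swap] at this

/-- A closed family that contains the triples of consecutive elements of a sequence contains all
triples of elements of the sequence. -/
theorem mem_of_consecutive (hZ : IsClosedFamily 2 Z) {m : ℕ} {s : ℕ → Fin n}
    (hs : ∀ p q, p < q → q < m + 2 → s p < s q)
    (h : ∀ l, l < m → {s l, s (l + 1), s (l + 2)} ∈ Z) {p q r : ℕ} (hpq : p < q) (hqr : q < r)
    (hr : r < m + 2) : {s p, s q, s r} ∈ Z := by
  -- Triples with an adjacent pair at the left or right end, by induction on the span. The two kinds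
  -- go together: each step combines a left one from `p` with a right one from `p + 1`.
  have key : ∀ d p, (p + d + 2 < m + 2 → {s p, s (p + 1), s (p + d + 2)} ∈ Z) ∧
      (p + d + 2 < m + 2 → {s p, s (p + d + 1), s (p + d + 2)} ∈ Z) := by
    intro d
    induction d with
    | zero => exact fun p => ⟨fun hp => h p (by omega), fun hp => h p (by omega)⟩
    | succ d ih =>
      intro p
      refine ⟨fun hp => ?_, fun hp => ?_⟩
      · have h1 := (ih p).1 (by omega)
        have h4 := (ih (p + 1)).2 (by omega)
        rw [show p + 1 + d + 1 = p + d + 2 by ring] at h4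
        rw [show p + 1 + d + 2 = p + (d + 1) + 2 by ring] at h4
        exact hZ.mem_second_of_first_fourth (hs _ _ (by omega) (by omega))
          (hs _ _ (by omega) (by omega)) (hs _ _ (by omega) (by omega)) h1 h4
      · have h1 := (ih p).1 (by omega)
        have h4 := (ih (p + 1)).2 (by omega)
        rw [show p + 1 + d + 1 = p + d + 2 by ring] at h4
        rw [show p + 1 + d + 2 = p + (d + 1) + 2 by ring] at h4
        exact hZ.mem_third_of_first_fourth (hs _ _ (by omega) (by omega))
          (hs _ _ (by omega) (by omega)) (hs _ _ (by omega) (by omega)) h1 h4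
  have key' : ∀ p r, p < r → r + 1 < m + 2 → {s p, s r, s (r + 1)} ∈ Z := by
    intro p r hp hr
    obtain ⟨d, rfl⟩ := Nat.exists_eq_add_of_lt hp
    exact (key d p).2 (by omega)
  -- The last index moves from `r` to `r + 1` by means of the triple `q`, `r`, `r + 1`.
  induction r, (show q + 1 ≤ r from hqr) using Nat.le_induction with
  | base => exact key' p q hpq hr
  | succ r hqr ih =>
    exact hZ.mem_second_of_first_fourth (hs _ _ (by omega) (by omega))
      (hs _ _ (by omega) (by omega)) (hs _ _ (by omega) (by omega))
      (ih (by omega) (by omega)) (key' q r (by omega) hr)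

end IsClosedFamily

/-- The closure of the consecutive triples of a sequence is the family of all its triples. -/
theorem closureFamily_consecutive {n m : ℕ} {s : ℕ → Fin n}
    (hs : ∀ p q, p < q → q < m + 2 → s p < s q) :
    closureFamily 2 {T | ∃ l < m, T = {s l, s (l + 1), s (l + 2)}} =
      {T | T ∈ levelSets n 2 ∧ ∀ x ∈ T, ∃ l < m + 2, x = s l} := by
  apply Subset.antisymm
  · refine sInter_subset_of_mem ⟨isClosedFamily_two_iff.2 ⟨fun T hT => hT.1, ?_⟩, ?_⟩
    · intro a i j k hai haj hak hij hjk h1 h2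
      refine ⟨triple_mem_levelSets hai hak (by omega), fun x hx => ?_⟩
      simp only [Finset.mem_insert, Finset.mem_singleton] at hx
      rcases hx with rfl | rfl | rfl
      · exact h1.2 _ (by simp)
      · exact h1.2 _ (by simp)
      · exact h2.2 _ (by simp)
    · rintro T ⟨l, hl, rfl⟩
      have h1 := hs l (l + 1) (by omega) (by omega)
      have h2 := hs (l + 1) (l + 2) (by omega) (by omega)
      refine ⟨triple_mem_levelSets h1.ne (h1.trans h2).ne h2.ne, fun x hx => ?_⟩
      simp only [Finset.mem_insert, Finset.mem_singleton] at hx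
      rcases hx with rfl | rfl | rfl
      · exact ⟨l, by omega, rfl⟩
      · exact ⟨l + 1, by omega, rfl⟩
      · exact ⟨l + 2, by omega, rfl⟩
  · rintro T ⟨hT, hTs⟩ Z ⟨hZ, hIZ⟩
    have hcons : ∀ l, l < m → {s l, s (l + 1), s (l + 2)} ∈ Z := fun l hl => hIZ ⟨l, hl, rfl⟩
    obtain ⟨x, y, z, hxy, hxz, hyz, rfl⟩ := Finset.card_eq_three.1 hT
    obtain ⟨a, ha, rfl⟩ := hTs x (by simp)
    obtain ⟨b, hb, rfl⟩ := hTs y (by simp)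
    obtain ⟨c, hc, rfl⟩ := hTs z (by simp)
    have hab : a ≠ b := fun h => hxy (by rw [h])
    have hac : a ≠ c := fun h => hxz (by rw [h])
    have hbc : b ≠ c := fun h => hyz (by rw [h])
    have key := @IsClosedFamily.mem_of_consecutive n Z hZ m s hs hcons
    rcases lt_or_gt_of_ne hab with h1 | h1 <;> rcases lt_or_gt_of_ne hac with h2 | h2 <;>
      rcases lt_or_gt_of_ne hbc with h3 | h3
    · exact key h1 h3 hc
    · rw [triple_swap, triple_rotate]; exact key h2 h3 hb
    · omega
    · rw [triple_rotate, triple_rotate]; exact key h2 h1 hb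
    · rw [triple_swap]; exact key h1 h2 hc
    · omega
    · rw [triple_rotate]; exact key h3 h2 ha
    · rw [triple_swap, triple_rotate, triple_rotate]; exact key h3 h1 ha

/-! ### Order of crossings and consistency of the inversion set -/

namespace WiringDiagram

variable {n : ℕ} (W : WiringDiagram n)

theorem eq_cross {i j : Fin n} (h : i ≠ j) {t : ℝ} (ht : W.wire i t = W.wire j t) :
    t = W.cross i j :=
  (W.existsUnique_crossing i j h).unique ht (W.wire_cross h)

theorem cross_comm (i j : Fin n) : W.cross i j = W.cross j i := by
  rcases eq_or_ne i j with rfl | h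
  · rfl
  · exact W.eq_cross h.symm (W.wire_cross h).symm

/-- Otherwise the order far to the right and the intermediate value theorem would give a second
crossing. -/
theorem wire_lt_of_cross_lt {i j : Fin n} (h : i < j) {t : ℝ} (ht : W.cross i j < t) :
    W.wire j t < W.wire i t := by
  by_contra! hle
  obtain ⟨x, hx, htx⟩ := ((W.order_right.and (eventually_ge_atTop t)).exists)
  have hlt := hx i j h
  have hc : ContinuousOn (fun y => W.wire j y - W.wire i y) (Icc t x) :=
    ((W.continuous_wire j).sub (W.continuous_wire i)).continuousOn
  obtain ⟨y, hy, hy0⟩ := intermediate_value_Icc' htx hc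
    (show (0 : ℝ) ∈ Icc _ _ from ⟨by linarith, by linarith⟩)
  have := W.eq_cross h.ne (t := y) (by simp only at hy0; linarith)
  linarith [hy.1]

/-- No order is prescribed far to the left. Transversality supplies it just left of the crossing,
and a change further left would again give a second crossing. -/
theorem wire_lt_of_lt_cross {i j : Fin n} (h : i < j) {t : ℝ} (ht : t < W.cross i j) :
    W.wire i t < W.wire j t := by
  have hleft : ∀ᶠ y in 𝓝[<] (W.cross i j), W.wire i y < W.wire j y := by
    rcases W.transverse i j h.ne _ (W.wire_cross h.ne) with h' | h'
    · exact h'.1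
    · obtain ⟨y, hy, hy'⟩ := (h'.2.and self_mem_nhdsWithin).exists
      exact absurd hy (W.wire_lt_of_cross_lt h hy').asymm
  by_contra! hle
  obtain ⟨x, hx, htx⟩ := (hleft.and (Ioo_mem_nhdsLT ht)).exists
  have hc : ContinuousOn (fun y => W.wire j y - W.wire i y) (Icc t x) :=
    ((W.continuous_wire j).sub (W.continuous_wire i)).continuousOn
  obtain ⟨y, hy, hy0⟩ := intermediate_value_Icc htx.1.le hc
    (show (0 : ℝ) ∈ Icc _ _ from ⟨by linarith, by linarith⟩)
  have := W.eq_cross h.ne (t := y) (by simp only at hy0; linarith)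
  linarith [hy.2, htx.2]

theorem wire_lt_iff {i j : Fin n} (h : i < j) {t : ℝ} :
    W.wire i t < W.wire j t ↔ t < W.cross i j := by
  refine ⟨fun hlt => ?_, W.wire_lt_of_lt_cross h⟩
  by_contra! hle
  rcases hle.lt_or_eq with h' | rfl
  · exact (W.wire_lt_of_cross_lt h h').asymm hlt
  · exact hlt.ne (W.wire_cross h.ne)

theorem wire_gt_iff {i j : Fin n} (h : i < j) {t : ℝ} :
    W.wire j t < W.wire i t ↔ W.cross i j < t := by
  refine ⟨fun hlt => ?_, W.wire_lt_of_cross_lt h⟩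
  by_contra! hle
  rcases hle.lt_or_eq with h' | rfl
  · exact (W.wire_lt_of_lt_cross h h').asymm hlt
  · exact hlt.ne' (W.wire_cross h.ne)

theorem wire_le_iff {i j : Fin n} (h : i < j) {t : ℝ} :
    W.wire i t ≤ W.wire j t ↔ t ≤ W.cross i j := by
  rw [← not_lt, ← not_lt, W.wire_gt_iff h]

theorem wire_ge_iff {i j : Fin n} (h : i < j) {t : ℝ} :
    W.wire j t ≤ W.wire i t ↔ W.cross i j ≤ t := by
  rw [← not_lt, ← not_lt, W.wire_lt_iff h]

/-- A wire that goes from above to below another one has the larger index. -/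
theorem lt_of_wire_lt {a b : Fin n} {t₁ t₂ : ℝ} (h1 : W.wire a t₁ < W.wire b t₁)
    (h2 : W.wire b t₂ < W.wire a t₂) (ht : t₁ < t₂) :
    a < b ∧ t₁ < W.cross a b ∧ W.cross a b < t₂ := by
  rcases lt_trichotomy a b with h | rfl | h
  · exact ⟨h, (W.wire_lt_iff h).1 h1, (W.wire_gt_iff h).1 h2⟩
  · exact absurd h1 (lt_irrefl _)
  · have := (W.wire_gt_iff h).1 h1
    have := (W.wire_lt_iff h).1 h2
    linarith

/-- A wire below another one at two abscissas is below it in between. -/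
theorem wire_lt_of_between {a b : Fin n} {t₁ t₂ t : ℝ} (h1 : W.wire a t₁ < W.wire b t₁)
    (h2 : W.wire a t₂ < W.wire b t₂) (ht₁ : t₁ ≤ t) (ht₂ : t ≤ t₂) :
    W.wire a t < W.wire b t := by
  rcases lt_trichotomy a b with h | rfl | h
  · rw [W.wire_lt_iff h] at *; linarith
  · exact absurd h1 (lt_irrefl _)
  · rw [W.wire_gt_iff h] at *; linarith

variable {W} {u v w : Fin n}

theorem IsSimple.cross_ne (hW : W.IsSimple) (h1 : u ≠ v) (h2 : u ≠ w) (h3 : v ≠ w) :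
    W.cross u v ≠ W.cross u w := by
  intro h
  refine hW v u w h1.symm h2 h3 (W.cross u v) ⟨(W.wire_cross h1).symm, ?_⟩
  rw [h]
  exact W.wire_cross h2

theorem mem_inversionSet_iff (huv : u < v) (hvw : v < w) :
    {u, v, w} ∈ W.inversionSet ↔ W.wire u (W.cross u w) < W.wire v (W.cross u w) := by
  constructor
  · rintro ⟨i, j, k, hij, hjk, h, hlt⟩
    obtain ⟨rfl, rfl, rfl⟩ := triple_eq_iff huv hvw hij hjk h
    exact hlt
  · exact fun h => ⟨u, v, w, huv, hvw, rfl, h⟩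

/-- The crossing of `u` and `w` lies on both wires. Comparing its height with `v` therefore places
it relative to the crossing of `u`, `v` and relative to that of `v`, `w`; simplicity excludes ties.
-/
theorem IsSimple.cross_order (hW : W.IsSimple) (huv : u < v) (hvw : v < w) :
    ({u, v, w} ∈ W.inversionSet ∧ W.cross v w < W.cross u w ∧ W.cross u w < W.cross u v) ∨
    ({u, v, w} ∉ W.inversionSet ∧ W.cross u v < W.cross u w ∧ W.cross u w < W.cross v w) := by
  have huw := huv.trans hvw
  have hne := hW.cross_ne huv.ne huw.ne hvw.ne
  have heq := W.wire_cross huw.ne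
  by_cases h : {u, v, w} ∈ W.inversionSet
  · refine Or.inl ⟨h, ?_, ?_⟩
    · rw [mem_inversionSet_iff huv hvw, heq] at h
      exact (W.wire_gt_iff hvw).1 h
    · rw [mem_inversionSet_iff huv hvw] at h
      exact (W.wire_lt_iff huv).1 h
  · refine Or.inr ⟨h, ?_⟩
    rw [mem_inversionSet_iff huv hvw, W.wire_lt_iff huv, not_lt] at h
    have h1 := lt_of_le_of_ne h hne
    refine ⟨h1, ?_⟩
    rw [← W.wire_gt_iff huv, heq] at h1
    exact (W.wire_lt_iff hvw).1 h1

theorem IsSimple.order_of_mem (hW : W.IsSimple) (huv : u < v) (hvw : v < w)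
    (h : {u, v, w} ∈ W.inversionSet) :
    W.cross v w < W.cross u w ∧ W.cross u w < W.cross u v := by
  rcases hW.cross_order huv hvw with h' | h'
  · exact h'.2
  · exact absurd h h'.1

theorem IsSimple.order_of_notMem (hW : W.IsSimple) (huv : u < v) (hvw : v < w)
    (h : {u, v, w} ∉ W.inversionSet) :
    W.cross u v < W.cross u w ∧ W.cross u w < W.cross v w := by
  rcases hW.cross_order huv hvw with h' | h'
  · exact absurd h'.1 h
  · exact h'.2

/-- Membership in the inversion set is read off the order of the crossings on any of the three
wires. -/
theorem IsSimple.mem_iff_cross_lt (hW : W.IsSimple) {a p q : Fin n} (hap : a ≠ p) (haq : a ≠ q)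
    (hpq : p < q) : {a, p, q} ∈ W.inversionSet ↔ W.cross a q < W.cross a p := by
  rcases lt_or_gt_of_ne hap with h1 | h1
  · rcases hW.cross_order h1 hpq with ⟨h, h2, h3⟩ | ⟨h, h2, h3⟩ <;> simp only [h, true_iff, false_iff]
      <;> linarith
  rcases lt_or_gt_of_ne haq with h2 | h2
  · rw [triple_swap, W.cross_comm a p]
    rcases hW.cross_order h1 h2 with ⟨h, h2, h3⟩ | ⟨h, h2, h3⟩ <;> simp only [h, true_iff, false_iff]
      <;> linarith
  · rw [triple_rotate, W.cross_comm a p, W.cross_comm a q]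
    rcases hW.cross_order hpq h2 with ⟨h, h2, h3⟩ | ⟨h, h2, h3⟩ <;> simp only [h, true_iff, false_iff]
      <;> linarith

theorem inversionSet_subset_levelSets : W.inversionSet ⊆ levelSets n 2 := by
  rintro T ⟨i, j, k, hij, hjk, rfl, -⟩
  exact triple_mem_levelSets hij.ne (hij.trans hjk).ne hjk.ne

/-- By `mem_iff_cross_lt`, membership of triples containing `a` compares crossings along wire `a`,
so both closedness conditions are transitivity of the order on the line. -/
theorem IsSimple.isConsistent_inversionSet (hW : W.IsSimple) : IsConsistent 2 W.inversionSet := by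
  refine ⟨isClosedFamily_two_iff.2 ⟨inversionSet_subset_levelSets, ?_⟩,
    isClosedFamily_two_iff.2 ⟨sdiff_subset, ?_⟩⟩
  · intro a i j k hi hj hk hij hjk
    rw [hW.mem_iff_cross_lt hi hj hij, hW.mem_iff_cross_lt hj hk hjk,
      hW.mem_iff_cross_lt hi hk (hij.trans hjk)]
    intro h1 h2
    linarith
  · rintro a i j k hi hj hk hij hjk ⟨-, h1⟩ ⟨-, h2⟩
    refine ⟨triple_mem_levelSets hi hk (hij.trans hjk).ne, ?_⟩
    rw [hW.mem_iff_cross_lt hi hj hij] at h1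
    rw [hW.mem_iff_cross_lt hj hk hjk] at h2
    rw [hW.mem_iff_cross_lt hi hk (hij.trans hjk)]
    linarith

end WiringDiagram

/-! ### Chains and the consistency criterion -/

namespace WiringDiagram

variable {n : ℕ}

/-- The wires `s 0, …, s (m + 1)` form a chain: all their triples are non-inversions, so that their
consecutive crossings are vertices of their lower envelope, and no wire crosses the lower envelope
strictly between two consecutive vertices. -/
structure IsChain (W : WiringDiagram n) (m : ℕ) (s : ℕ → Fin n) : Prop where
  lt : ∀ {p q : ℕ}, p < q → q < m + 2 → s p < s q
  notMem : ∀ {p q r : ℕ}, p < q → q < r → r < m + 2 → {s p, s q, s r} ∉ W.inversionSet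
  elementary : ∀ l < m, ∀ x ≠ s (l + 1),
    W.cross (s l) (s (l + 1)) < W.cross (s (l + 1)) x →
      ¬ W.cross (s (l + 1)) x < W.cross (s (l + 1)) (s (l + 2))

/-- The abscissa of the crossing of two consecutive wires of a sequence. -/
noncomputable def vertex (W : WiringDiagram n) (s : ℕ → Fin n) (l : ℕ) : ℝ :=
  W.cross (s l) (s (l + 1))

/-- The wire `x` passes above all vertices of the chain. -/
def IsAbove (W : WiringDiagram n) (m : ℕ) (s : ℕ → Fin n) (x : Fin n) : Prop :=
  ∀ l ≤ m, W.wire (s l) (W.vertex s l) < W.wire x (W.vertex s l)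

/-- The wire `x` passes below all vertices of the chain. -/
def IsBelow (W : WiringDiagram n) (m : ℕ) (s : ℕ → Fin n) (x : Fin n) : Prop :=
  ∀ l ≤ m, W.wire x (W.vertex s l) < W.wire (s l) (W.vertex s l)

/-- The wire `x` is not one of the wires `s 0, …, s (m + 1)`. -/
def IsOutside (m : ℕ) (s : ℕ → Fin n) (x : Fin n) : Prop := ∀ l < m + 2, x ≠ s l

namespace IsChain

variable {W : WiringDiagram n} {m : ℕ} {s : ℕ → Fin n} {x : Fin n} {p q r l : ℕ}

theorem wire_vertex (hc : W.IsChain m s) (hl : l ≤ m) :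
    W.wire (s l) (W.vertex s l) = W.wire (s (l + 1)) (W.vertex s l) :=
  W.wire_cross (hc.lt (by omega) (by omega)).ne

theorem cross_order (hc : W.IsChain m s) (hW : W.IsSimple) (hpq : p < q) (hqr : q < r)
    (hr : r < m + 2) :
    W.cross (s p) (s q) < W.cross (s p) (s r) ∧ W.cross (s p) (s r) < W.cross (s q) (s r) :=
  hW.order_of_notMem (hc.lt hpq (by omega)) (hc.lt hqr hr) (hc.notMem hpq hqr hr)

theorem vertex_le_cross (hc : W.IsChain m s) (hW : W.IsSimple) (hpq : p < q) (hq : q < m + 2) :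
    W.vertex s p ≤ W.cross (s p) (s q) := by
  rcases (show p + 1 ≤ q from hpq).eq_or_lt with rfl | h
  · exact le_rfl
  · exact (hc.cross_order hW (Nat.lt_succ_self p) h hq).1.le

theorem cross_le_vertex (hc : W.IsChain m s) (hW : W.IsSimple) (hpq : p ≤ q) (hq : q + 1 < m + 2) :
    W.cross (s p) (s (q + 1)) ≤ W.vertex s q := by
  rcases hpq.eq_or_lt with rfl | h
  · exact le_rfl
  · exact (hc.cross_order hW h (Nat.lt_succ_self q) hq).2.le

theorem vertex_mono (hc : W.IsChain m s) (hW : W.IsSimple) (hpq : p ≤ q) (hq : q ≤ m) :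
    W.vertex s p ≤ W.vertex s q :=
  (hc.vertex_le_cross hW (show p < q + 1 by omega) (by omega)).trans
    (hc.cross_le_vertex hW hpq (by omega))

/-- The vertices of a chain lie on the lower envelope of its wires. -/
theorem wire_vertex_le (hc : W.IsChain m s) (hW : W.IsSimple) (hl : l ≤ m) (hp : p < m + 2) :
    W.wire (s l) (W.vertex s l) ≤ W.wire (s p) (W.vertex s l) := by
  rcases lt_trichotomy p l with h | rfl | h
  · rw [W.wire_ge_iff (hc.lt h (by omega))]
    exact ((hc.cross_order hW h (Nat.lt_succ_self l) (by omega)).1.trans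
      (hc.cross_order hW h (Nat.lt_succ_self l) (by omega)).2).le
  · exact le_rfl
  · rw [W.wire_le_iff (hc.lt h hp)]
    exact hc.vertex_le_cross hW h hp

/-- Simplicity keeps an outside wire off the vertices. To change sides between two successive
vertices it would have to cross the floor joining them. -/
theorem isAbove_or_isBelow (hc : W.IsChain m s) (hW : W.IsSimple) (hx : IsOutside m s x) :
    W.IsAbove m s x ∨ W.IsBelow m s x := by
  have hne : ∀ l ≤ m, W.wire x (W.vertex s l) ≠ W.wire (s l) (W.vertex s l) := fun l hl h =>
    hW x (s l) (s (l + 1)) (hx _ (by omega)) (hc.lt (by omega) (by omega)).ne (hx _ (by omega))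
      (W.vertex s l) ⟨h, hc.wire_vertex hl⟩
  have step : ∀ l < m, (W.wire (s l) (W.vertex s l) < W.wire x (W.vertex s l) ↔
      W.wire (s (l + 1)) (W.vertex s (l + 1)) < W.wire x (W.vertex s (l + 1))) := by
    intro l hl
    have hv : W.vertex s l < W.vertex s (l + 1) :=
      (hc.cross_order hW (Nat.lt_succ_self l) (Nat.lt_succ_self (l + 1)) (by omega)).1.trans
        (hc.cross_order hW (Nat.lt_succ_self l) (Nat.lt_succ_self (l + 1)) (by omega)).2
    have hnl := hne l (by omega)
    have hnl' := hne (l + 1) (by omega)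
    -- Both vertices are now regarded as points of `s (l + 1)`, so `x` is compared with a single
    -- wire.
    rw [hc.wire_vertex (by omega)] at hnl ⊢
    have hel := hc.elementary l hl x (hx _ (by omega))
    constructor
    · intro h
      by_contra! h'
      have := W.lt_of_wire_lt h (lt_of_le_of_ne h' hnl') hv
      exact hel this.2.1 this.2.2
    · intro h
      by_contra! h'
      have := W.lt_of_wire_lt (lt_of_le_of_ne h' hnl) h hv
      rw [W.cross_comm] at this
      exact hel this.2.1 this.2.2
  have all : ∀ l ≤ m, (W.wire (s 0) (W.vertex s 0) < W.wire x (W.vertex s 0) ↔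
      W.wire (s l) (W.vertex s l) < W.wire x (W.vertex s l)) := by
    intro l
    induction l with
    | zero => exact fun _ => Iff.rfl
    | succ l ih => exact fun hl => (ih (by omega)).trans (step l (by omega))
  by_cases h : W.wire (s 0) (W.vertex s 0) < W.wire x (W.vertex s 0)
  · exact Or.inl fun l hl => (all l hl).1 h
  · exact Or.inr fun l hl => lt_of_le_of_ne (not_lt.1 (mt (all l hl).2 h)) (hne l hl)

theorem _root_.HigherBruhat.WiringDiagram.IsBelow.wire_lt (hx : W.IsBelow m s x)
    (hc : W.IsChain m s) (hW : W.IsSimple) (hl : l ≤ m) (hp : p < m + 2) :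
    W.wire x (W.vertex s l) < W.wire (s p) (W.vertex s l) :=
  (hx l hl).trans_le (hc.wire_vertex_le hW hl hp)

theorem _root_.HigherBruhat.WiringDiagram.IsAbove.wire_lt_right (hx : W.IsAbove m s x)
    (hc : W.IsChain m s) (hl : l ≤ m) :
    W.wire (s (l + 1)) (W.vertex s l) < W.wire x (W.vertex s l) := by
  rw [← hc.wire_vertex hl]; exact hx l hl

/-- A wire below the chain forms an inversion with exactly those pairs of wires of the chain that
do not have it in between. -/
theorem mem_iff_of_isBelow (hc : W.IsChain m s) (hW : W.IsSimple) (hx : IsOutside m s x)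
    (hb : W.IsBelow m s x) (hpq : p < q) (hq : q < m + 2) :
    {x, s p, s q} ∈ W.inversionSet ↔ ¬ (s p < x ∧ x < s q) := by
  obtain ⟨q, rfl⟩ : ∃ q', q = q' + 1 := ⟨q - 1, by omega⟩
  have hlt := hc.lt hpq hq
  have h1 := hc.vertex_le_cross hW hpq hq
  have h2 := hc.cross_le_vertex hW (show p ≤ q by omega) hq
  have hnp := hx p (by omega)
  have hnq := hx (q + 1) (by omega)
  rcases lt_or_gt_of_ne hnp with h | h
  · have h3 := (W.wire_lt_iff h).1 (hb.wire_lt hc hW (show q ≤ m by omega)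
      (show p < m + 2 by omega))
    have : {x, s p, s (q + 1)} ∈ W.inversionSet := by
      rcases hW.cross_order h hlt with h' | h'
      · exact h'.1
      · linarith [h'.2]
    simp only [this, true_iff]
    omega
  · rcases lt_or_gt_of_ne hnq with h' | h'
    · have h3 := (W.wire_gt_iff h).1 (hb.wire_lt hc hW (show p ≤ m by omega)
        (show p < m + 2 by omega))
      have h4 := (W.wire_lt_iff h').1 (hb.wire_lt hc hW (show q ≤ m by omega) hq)
      rw [hW.mem_iff_cross_lt hnp hnq hlt, W.cross_comm x (s p)]
      simp only [h, h', and_self, not_true, iff_false]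
      linarith [hc.vertex_mono hW (show p ≤ q by omega) (by omega)]
    · have h3 := (W.wire_gt_iff h').1 (hb.wire_lt hc hW (show p ≤ m by omega) hq)
      rw [triple_rotate]
      have : {s p, s (q + 1), x} ∈ W.inversionSet := by
        rcases hW.cross_order hlt h' with h' | h'
        · exact h'.1
        · linarith [h'.2]
      simp only [this, true_iff]
      omega

/-- A wire above the chain forms no inversion with a pair of wires of the chain that does not have
it in between. -/
theorem between_of_isAbove (hc : W.IsChain m s) (hW : W.IsSimple) (hx : IsOutside m s x)
    (ha : W.IsAbove m s x) (hpq : p < q) (hq : q < m + 2)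
    (hmem : {x, s p, s q} ∈ W.inversionSet) : s p < x ∧ x < s q := by
  obtain ⟨q, rfl⟩ : ∃ q', q = q' + 1 := ⟨q - 1, by omega⟩
  have hlt := hc.lt hpq hq
  have h1 := hc.vertex_le_cross hW hpq hq
  have h2 := hc.cross_le_vertex hW (show p ≤ q by omega) hq
  have hnp := hx p (by omega)
  have hnq := hx (q + 1) (by omega)
  constructor
  · by_contra! h
    have h := lt_of_le_of_ne h hnp
    -- Being above vertex `p`, `x` crosses `s p` before that vertex, hence before `s p` meets `s (q
    -- + 1)`; an inversion needs the opposite order.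
    have h3 := (W.wire_gt_iff h).1 (ha p (by omega))
    have := hW.order_of_mem h hlt hmem
    linarith
  · by_contra! h
    have h := lt_of_le_of_ne h hnq.symm
    have h3 := (W.wire_lt_iff h).1 (ha.wire_lt_right hc (show q ≤ m by omega))
    rw [triple_rotate] at hmem
    have := hW.order_of_mem hlt h hmem
    linarith

/-- A wire above the chain forms an inversion with two consecutive wires of the chain that have
it in between. -/
theorem mem_of_isAbove (hW : W.IsSimple) (ha : W.IsAbove m s x) (hl : l ≤ m)
    (h1 : s l < x) (h2 : x < s (l + 1)) : {s l, x, s (l + 1)} ∈ W.inversionSet := by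
  have h3 := (W.wire_lt_iff h1).1 (ha l hl)
  rcases hW.cross_order h1 h2 with h | h
  · exact h.1
  · have : W.vertex s l = W.cross (s l) (s (l + 1)) := rfl
    linarith [h.2]

/-- If every wire above the chain forms an inversion with all pairs of wires of the chain that have
it in between, then the triples of the chain can be added to the inversion set. -/
theorem isConsistent_union (hc : W.IsChain m s) (hW : W.IsSimple)
    (habove : ∀ x, IsOutside m s x → W.IsAbove m s x → ∀ p q, p < q → q < m + 2 →
      s p < x → x < s q → {x, s p, s q} ∈ W.inversionSet) :
    IsConsistent 2 (W.inversionSet ∪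
      {T | T ∈ levelSets n 2 ∧ ∀ x ∈ T, ∃ l < m + 2, x = s l}) := by
  set C := {T : Finset (Fin n) | T ∈ levelSets n 2 ∧ ∀ x ∈ T, ∃ l < m + 2, x = s l} with hC
  have memC : ∀ {a b c : Fin n}, a ≠ b → a ≠ c → b ≠ c → (({a, b, c} : Finset (Fin n)) ∈ C ↔
      ¬ IsOutside m s a ∧ ¬ IsOutside m s b ∧ ¬ IsOutside m s c) := by
    intro a b c hab hac hbc
    simp only [hC, mem_ofPred_eq, triple_mem_levelSets hab hac hbc, true_and, Finset.mem_insert,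
      Finset.mem_singleton, forall_eq_or_imp, forall_eq, IsOutside, not_forall, not_not,
      exists_prop]
  -- An outside wire sees the chain in one of two ways: its inversions are exactly the pairs that
  -- separate it, or exactly those that do not.
  have status : ∀ x, IsOutside m s x →
      (∀ a b, ¬ IsOutside m s a → ¬ IsOutside m s b → a < b →
        ({x, a, b} ∈ W.inversionSet ↔ (a < x ∧ x < b))) ∨
      (∀ a b, ¬ IsOutside m s a → ¬ IsOutside m s b → a < b →
        ({x, a, b} ∈ W.inversionSet ↔ ¬ (a < x ∧ x < b))) := by
    intro x hx
    have conv : ∀ {a b}, ¬ IsOutside m s a → ¬ IsOutside m s b → a < b →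
        ∃ p q, p < q ∧ q < m + 2 ∧ a = s p ∧ b = s q := by
      intro a b ha hb hab
      simp only [IsOutside, not_forall, not_not] at ha hb
      obtain ⟨p, hp, rfl⟩ := ha
      obtain ⟨q, hq, rfl⟩ := hb
      refine ⟨p, q, ?_, hq, rfl, rfl⟩
      by_contra! h
      rcases h.eq_or_lt with rfl | h
      · exact absurd hab (lt_irrefl _)
      · exact hab.asymm (hc.lt h hp)
    rcases hc.isAbove_or_isBelow hW hx with h | h
    · refine Or.inl fun a b ha hb hab => ?_
      obtain ⟨p, q, hpq, hq, rfl, rfl⟩ := conv ha hb hab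
      exact ⟨hc.between_of_isAbove hW hx h hpq hq,
        fun h' => habove x hx h p q hpq hq h'.1 h'.2⟩
    · refine Or.inr fun a b ha hb hab => ?_
      obtain ⟨p, q, hpq, hq, rfl, rfl⟩ := conv ha hb hab
      exact hc.mem_iff_of_isBelow hW hx h hpq hq
  have status' : ∀ x, IsOutside m s x →
      (∀ a b, ¬ IsOutside m s a → ¬ IsOutside m s b → a ≠ b →
        ({x, a, b} ∈ W.inversionSet ↔ (a < x ∧ x < b ∨ b < x ∧ x < a))) ∨
      (∀ a b, ¬ IsOutside m s a → ¬ IsOutside m s b → a ≠ b →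
        ({x, a, b} ∈ W.inversionSet ↔ ¬ (a < x ∧ x < b ∨ b < x ∧ x < a))) := by
    intro x hx
    refine (status x hx).imp (fun h a b ha hb hab => ?_) (fun h a b ha hb hab => ?_) <;>
    · rcases lt_or_gt_of_ne hab with h' | h'
      · rw [h a b ha hb h']
        omega
      · rw [triple_rotate, triple_swap, triple_rotate, triple_rotate, h b a hb ha h']
        omega
  obtain ⟨h1, h2⟩ := hW.isConsistent_inversionSet
  rw [isClosedFamily_two_iff] at h1 h2
  refine ⟨isClosedFamily_two_iff.2 ⟨union_subset h1.1 fun T hT => hT.1, ?_⟩,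
    isClosedFamily_two_iff.2 ⟨sdiff_subset, ?_⟩⟩
  · intro a i j k hai haj hak hij hjk
    have hik := hij.trans hjk
    simp only [mem_union, memC hai haj hij.ne, memC haj hak hjk.ne, memC hai hak hik.ne]
    rintro (hX1 | hC1) (hX2 | hC2)
    · exact Or.inl (h1.2 a i j k hai haj hak hij hjk hX1 hX2)
    -- Since `i < j < k`, the pairs `a, j` and `a, k` either both separate `i` or both do not, so
    -- the two triples have the same status. The next case is symmetric, with `k` outside.
    · by_cases hi : IsOutside m s i
      · left
        rw [triple_swap] at hX1 ⊢
        rcases status' i hi with h | h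
        · rw [h a j hC2.1 hC2.2.1 haj] at hX1
          rw [h a k hC2.1 hC2.2.2 hak]
          omega
        · rw [h a j hC2.1 hC2.2.1 haj] at hX1
          rw [h a k hC2.1 hC2.2.2 hak]
          omega
      · exact Or.inr ⟨hC2.1, hi, hC2.2.2⟩
    · by_cases hk : IsOutside m s k
      · left
        rw [triple_rotate, triple_rotate] at hX2 ⊢
        rcases status' k hk with h | h
        · rw [h a j hC1.1 hC1.2.2 haj] at hX2
          rw [h a i hC1.1 hC1.2.1 hai]
          omega
        · rw [h a j hC1.1 hC1.2.2 haj] at hX2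
          rw [h a i hC1.1 hC1.2.1 hai]
          omega
      · exact Or.inr ⟨hC1.1, hC1.2.1, hk⟩
    · exact Or.inr ⟨hC1.1, hC1.2.1, hC2.2.2⟩
  · intro a i j k hai haj hak hij hjk
    have hik := hij.trans hjk
    have := h2.2 a i j k hai haj hak hij hjk
    simp only [Set.mem_sdiff, mem_union, memC hai haj hij.ne, memC haj hak hjk.ne, memC hai hak hik.ne,
      triple_mem_levelSets hai haj hij.ne, triple_mem_levelSets haj hak hjk.ne,
      triple_mem_levelSets hai hak hik.ne, true_and, not_or] at this ⊢
    rintro ⟨hX1, hC1⟩ ⟨hX2, hC2⟩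
    refine ⟨this hX1 hX2, fun hC3 => ?_⟩
    -- With `a`, `i`, `k` on the chain and `i < j < k`, exactly one of the pairs `a, i` and `a, k`
    -- separates `j`. Hence exactly one of the two triples is an inversion, contrary to `hX1` and
    -- `hX2`.
    have hj : IsOutside m s j := by
      by_contra hj
      exact hC1 ⟨hC3.1, hC3.2.1, hj⟩
    rw [triple_rotate, triple_rotate] at hX1
    rw [triple_swap] at hX2
    rcases status' j hj with h | h
    · rw [h a i hC3.1 hC3.2.1 hai] at hX1
      rw [h a k hC3.1 hC3.2.2 hak] at hX2
      omega
    · rw [h a i hC3.1 hC3.2.1 hai] at hX1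
      rw [h a k hC3.1 hC3.2.2 hak] at hX2
      omega

end IsChain
end WiringDiagram
-- Floors, heights and lower envelopes
namespace WiringDiagram

variable {n : ℕ} {W : WiringDiagram n}

theorem isNonInversionTriple_iff {u v w : Fin n} (huv : u < v) (hvw : v < w) :
    W.IsNonInversionTriple {u, v, w} ↔ W.wire v (W.cross u w) < W.wire u (W.cross u w) := by
  constructor
  · rintro ⟨i, j, k, hij, hjk, h, hlt⟩
    obtain ⟨rfl, rfl, rfl⟩ := triple_eq_iff huv hvw hij hjk h
    exact hlt
  · exact fun h => ⟨u, v, w, huv, hvw, rfl, h⟩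

theorem IsNonInversionTriple.notMem {T : Finset (Fin n)} (h : W.IsNonInversionTriple T) :
    T ∉ W.inversionSet := by
  obtain ⟨i, j, k, hij, hjk, rfl, hlt⟩ := h
  rw [mem_inversionSet_iff hij hjk]
  exact hlt.asymm

theorem IsSimple.isNonInversionTriple (hW : W.IsSimple) {u v w : Fin n} (huv : u < v)
    (hvw : v < w) (h : {u, v, w} ∉ W.inversionSet) : W.IsNonInversionTriple {u, v, w} :=
  (isNonInversionTriple_iff huv hvw).2
    ((W.wire_gt_iff huv).2 (hW.order_of_notMem huv hvw h).1)

/-- In terms of crossings, an elementary floor has no crossing strictly between its end points. -/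
theorem hasElementaryFloor_iff {u v w : Fin n} (huv : u < v) (hvw : v < w)
    (h : W.cross u v ≤ W.cross v w) :
    W.HasElementaryFloor {u, v, w} ↔
      ∀ x ≠ v, W.cross u v < W.cross v x → ¬ W.cross v x < W.cross v w := by
  have hint : W.segmentInterior u v w =
      (fun x => (x, W.wire v x)) '' Ioo (W.cross u v) (W.cross v w) := by
    rw [segmentInterior, W.cross_comm w v, uIoo_of_le h]
  constructor
  · intro hel x hx h1 h2
    refine hel u v w huv hvw rfl (W.cross v x, W.wire v (W.cross v x)) ?_ x hx
      (W.wire_cross hx.symm).symm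
    rw [hint]
    exact ⟨_, ⟨h1, h2⟩, rfl⟩
  · intro hel i j k hij hjk hT q hq x hx heq
    obtain ⟨rfl, rfl, rfl⟩ := triple_eq_iff huv hvw hij hjk hT
    rw [hint] at hq
    obtain ⟨t, ht, rfl⟩ := hq
    have := W.eq_cross hx.symm (t := t) heq.symm
    subst this
    exact hel x hx ht.1 ht.2

theorem height_triple {u v w : Fin n} (huv : u < v) (hvw : v < w)
    (h : W.cross u v ≤ W.cross v w) :
    W.height {u, v, w} =
      {p : Fin n | ∀ t ∈ Icc (W.cross u v) (W.cross v w), W.wire p t < W.wire v t}.ncard := by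
  rw [height]
  congr 1
  ext p
  have hseg : W.segment u v w =
      (fun x => (x, W.wire v x)) '' Icc (W.cross u v) (W.cross v w) := by
    rw [segment, W.cross_comm w v, uIcc_of_le h]
  constructor
  · intro hp t ht
    refine hp (t, W.wire v t) ⟨u, v, w, huv, hvw, rfl, ?_⟩
    rw [hseg]
    exact ⟨t, ht, rfl⟩
  · rintro hp q ⟨i, j, k, hij, hjk, hT, hq⟩
    obtain ⟨rfl, rfl, rfl⟩ := triple_eq_iff huv hvw hij hjk hT
    rw [hseg] at hq
    obtain ⟨t, ht, rfl⟩ := hq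
    exact hp t ht

/-- The crossing of `v < w` lies on the lower envelope of the wires in `Z`. -/
structure IsEnvelopePair (W : WiringDiagram n) (Z : Finset (Fin n)) (v w : Fin n) : Prop where
  left_mem : v ∈ Z
  right_mem : w ∈ Z
  lt : v < w
  le : ∀ z ∈ Z, W.wire v (W.cross v w) ≤ W.wire z (W.cross v w)

/-- The vertex of the lower envelope that precedes a given one. -/
theorem IsEnvelopePair.exists_prev {Z : Finset (Fin n)} {v w : Fin n}
    (h : W.IsEnvelopePair Z v w) (hW : W.IsSimple) (hex : ∃ z ∈ Z, z < v) :
    ∃ u, W.IsEnvelopePair Z u v ∧ W.cross u v < W.cross v w ∧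
      ∀ z ∈ Z, z ≠ v → W.cross u v < W.cross v z → ¬ W.cross v z < W.cross v w := by
  obtain ⟨z₀, hz₀, hz₀v⟩ := hex
  -- The preceding envelope wire is the one of index below `v` that crosses `v` last.
  obtain ⟨u, hu, hmax⟩ := (Z.filter (· < v)).exists_max_image (fun z => W.cross z v)
    ⟨z₀, Finset.mem_filter.2 ⟨hz₀, hz₀v⟩⟩
  obtain ⟨huZ, huv⟩ := Finset.mem_filter.1 hu
  have hright : ∀ z ∈ Z, v < z → W.cross v w ≤ W.cross v z := fun z hz hvz =>
    (W.wire_le_iff hvz).1 (h.le z hz)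
  have huw : W.cross u v < W.cross v w := by
    refine lt_of_le_of_ne ((W.wire_ge_iff huv).1 (h.le u huZ)) ?_
    rw [W.cross_comm u v]
    exact hW.cross_ne huv.ne' h.lt.ne (huv.trans h.lt).ne
  refine ⟨u, ⟨huZ, h.left_mem, huv, fun z hz => ?_⟩, huw, fun z hz hzv h1 h2 => ?_⟩
  · rw [W.wire_cross huv.ne]
    rcases lt_trichotomy z v with hzv | rfl | hvz
    · exact (W.wire_ge_iff hzv).2 (hmax z (Finset.mem_filter.2 ⟨hz, hzv⟩))
    · exact le_rfl
    · exact (W.wire_le_iff hvz).2 (huw.le.trans (hright z hz hvz))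
  · rcases lt_or_gt_of_ne hzv with h' | h'
    · have := hmax z (Finset.mem_filter.2 ⟨hz, h'⟩)
      rw [W.cross_comm v z] at h1
      linarith
    · linarith [hright z hz h']

/-- The last vertex of the lower envelope. -/
theorem exists_isEnvelopePair_last {Z : Finset (Fin n)} {k : Fin n} (hk : k ∈ Z)
    (hmaxk : ∀ z ∈ Z, z ≤ k) (hex : ∃ z ∈ Z, z < k) :
    ∃ v, W.IsEnvelopePair Z v k ∧ ∀ z ∈ Z, z < k → W.cross z k ≤ W.cross v k := by
  obtain ⟨z₀, hz₀, hz₀v⟩ := hex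
  obtain ⟨v, hv, hmax⟩ := (Z.filter (· < k)).exists_max_image (fun z => W.cross z k)
    ⟨z₀, Finset.mem_filter.2 ⟨hz₀, hz₀v⟩⟩
  obtain ⟨hvZ, hvk⟩ := Finset.mem_filter.1 hv
  have hmax' : ∀ z ∈ Z, z < k → W.cross z k ≤ W.cross v k := fun z hz hzk =>
    hmax z (Finset.mem_filter.2 ⟨hz, hzk⟩)
  refine ⟨v, ⟨hvZ, hk, hvk, fun z hz => ?_⟩, hmax'⟩
  rw [W.wire_cross hvk.ne]
  rcases (hmaxk z hz).eq_or_lt with rfl | hzk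
  · exact le_rfl
  · exact (W.wire_ge_iff hzk).2 (hmax' z hz hzk)

/-- If a closed family contains none of the triples `{i, z, k}`, where `i` and `k` are the extreme
elements of `Z`, then it misses a triple of consecutive wires on the lower envelope of `Z`. -/
theorem IsSimple.exists_envelope_triple (hW : W.IsSimple) {N : Set (Finset (Fin n))}
    (hN : IsClosedFamily 2 N) {Z : Finset (Fin n)} {i k x : Fin n} (hi : i ∈ Z) (hk : k ∈ Z)
    (hmin : ∀ z ∈ Z, i ≤ z) (hmax : ∀ z ∈ Z, z ≤ k) (hx : x ∈ Z) (hix : i < x) (hxk : x < k)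
    (hixk : {i, x, k} ∉ W.inversionSet)
    (hZN : ∀ z ∈ Z, i < z → z < k → {i, z, k} ∉ N) :
    ∃ u v w, W.IsEnvelopePair Z u v ∧ W.IsEnvelopePair Z v w ∧ W.cross u v < W.cross v w ∧
      (∀ z ∈ Z, z ≠ v → W.cross u v < W.cross v z → ¬ W.cross v z < W.cross v w) ∧
      {u, v, w} ∉ N := by
  by_contra! hcon
  -- Walking along the envelope from `i`, with `u` the predecessor of `v`: `{i, u, v}` and `{u, v,
  -- w}` in `N` give `{i, v, w}` in `N`. At the last vertex this contradicts `hZN`.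
  have key : ∀ v w, W.IsEnvelopePair Z v w → i < v → {i, v, w} ∈ N := by
    intro v
    induction v using WellFoundedLT.induction with
    | ind v ih =>
      intro w hvw hiv
      obtain ⟨u, huv, hlt, hel⟩ := hvw.exists_prev hW ⟨i, hi, hiv⟩
      have huvw := hcon u v w huv hvw hlt
        fun z hz hzv h => not_lt.1 (hel z hz hzv h)
      rcases (hmin u huv.left_mem).eq_or_lt with rfl | hiu
      · exact huvw
      · exact hN.mem_third_of_first_fourth hiu huv.lt hvw.lt (ih u huv.lt v huv hiu) huvw
  obtain ⟨v, hvk, hv⟩ := exists_isEnvelopePair_last (W := W) hk hmax ⟨x, hx, hxk⟩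
  -- The wire `x` crosses `k` after `i` does, so `i` is not the last to cross `k`.
  have hiv : i < v := by
    refine lt_of_le_of_ne (hmin v hvk.left_mem) ?_
    rintro rfl
    have := hW.order_of_notMem hix hxk hixk
    linarith [hv x hx hxk]
  exact hZN v hvk.left_mem hiv hvk.lt (key v k hvk hiv)

end WiringDiagram
-- A higher elementary floor above an obstructed chain
namespace WiringDiagram

variable {n : ℕ} {W : WiringDiagram n} {m : ℕ} {s : ℕ → Fin n} {x : Fin n} {p q : ℕ}

/-- A consistent family containing the inversion set and the triples of a chain contains
`{s p, x, s q}` for every wire `x` above the chain with `s p < x < s q`. -/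
theorem IsChain.mem_of_isAbove_of_isClosedFamily (hc : W.IsChain m s) (hW : W.IsSimple)
    {Y : Set (Finset (Fin n))} (hY : IsClosedFamily 2 Y) (hXY : W.inversionSet ⊆ Y)
    (hcY : ∀ p q r, p < q → q < r → r < m + 2 → {s p, s q, s r} ∈ Y)
    (hx : IsOutside m s x) (ha : W.IsAbove m s x) (hpq : p < q) (hq : q < m + 2)
    (hpx : s p < x) (hxq : x < s q) : {s p, x, s q} ∈ Y := by
  -- With two consecutive chain wires around it, `x` forms an inversion, hence a triple of `Y`.
  -- Closedness then moves the outer wires to `s p` and `s q`.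
  obtain ⟨l, hpl, hlq, hlx, hxl⟩ : ∃ l, p ≤ l ∧ l < q ∧ s l < x ∧ x < s (l + 1) := by
    by_contra! hcon
    have : ∀ l, p ≤ l → l ≤ q → s l < x := by
      intro l hl
      induction l, hl using Nat.le_induction with
      | base => exact fun _ => hpx
      | succ l hl ih =>
        intro hlq
        exact lt_of_le_of_ne (hcon l hl (by omega) (ih (by omega))) (hx _ (by omega)).symm
    exact (this q hpq.le le_rfl).asymm hxq
  have h1 : {s l, x, s (l + 1)} ∈ Y := hXY (IsChain.mem_of_isAbove hW ha (by omega) hlx hxl)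
  have h2 : {s p, x, s (l + 1)} ∈ Y := by
    rcases hpl.eq_or_lt with rfl | h
    · exact h1
    · exact hY.mem_third_of_second_fourth (hc.lt h (by omega)) hlx hxl
        (hcY p l (l + 1) h (by omega) (by omega)) h1
  rcases (show l + 1 ≤ q from hlq).eq_or_lt with rfl | h
  · exact h2
  · exact hY.mem_second_of_first_third hpx hxl (hc.lt h hq) h2
      (hcY p (l + 1) q (by omega) h hq)

/-- Suppose that a wire above a chain enters the region between the chain and two of its wires
`s p`, `s q`, and that no such wire enters a smaller region of this kind. Then some triple of
consecutive wires on the lower envelope of the entering wires has an elementary floor above the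
chain. -/
theorem IsChain.exists_elementary_triple (hc : W.IsChain m s) (hW : W.IsSimple)
    {Y : Set (Finset (Fin n))} (hY : IsConsistent 2 Y) (hXY : W.inversionSet ⊆ Y)
    (hcY : ∀ p q r, p < q → q < r → r < m + 2 → {s p, s q, s r} ∈ Y)
    (hx : IsOutside m s x) (ha : W.IsAbove m s x) (hpq : p < q) (hq : q < m + 2)
    (hpx : s p < x) (hxq : x < s q) (hX : {s p, x, s q} ∉ W.inversionSet)
    (hminimal : ∀ p' q', p' < q' → q' < m + 2 → q' - p' < q - p → ∀ x, IsOutside m s x →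
      W.IsAbove m s x → s p' < x → x < s q' → {s p', x, s q'} ∈ W.inversionSet) :
    ∃ u v w, u < v ∧ v < w ∧ {u, v, w} ∈ Y ∧ {u, v, w} ∉ W.inversionSet ∧
      W.cross u v < W.cross v w ∧
      (∀ r ≠ v, W.cross u v < W.cross v r → ¬ W.cross v r < W.cross v w) ∧
      W.vertex s p ≤ W.cross u v ∧ W.cross v w ≤ W.vertex s (q - 1) ∧
      ∀ t ∈ Icc (W.cross u v) (W.cross v w), W.wire (s (p + 1)) t < W.wire v t := by
  classical
  obtain ⟨q, rfl⟩ : ∃ q', q = q' + 1 := ⟨q - 1, by omega⟩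
  -- Consecutive chain wires cannot be an obstructed pair, so `s (p + 1)` and `s q`, possibly equal,
  -- lie strictly between the two outer wires.
  have hpq' : p + 1 ≤ q := by
    by_contra h
    obtain rfl : p = q := by omega
    exact hX (IsChain.mem_of_isAbove hW ha (by omega) hpx hxq)
  have hik : s p < s (q + 1) := hpx.trans hxq
  set Q : Finset (Fin n) := Finset.univ.filter fun z => IsOutside m s z ∧ W.IsAbove m s z ∧
    s p < z ∧ z < s (q + 1) ∧ {s p, z, s (q + 1)} ∉ W.inversionSet with hQ
  have memQ : ∀ {z}, z ∈ Q ↔ IsOutside m s z ∧ W.IsAbove m s z ∧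
    s p < z ∧ z < s (q + 1) ∧ {s p, z, s (q + 1)} ∉ W.inversionSet := by simp [hQ]
  -- Entering wires cross `s p` and `s (q + 1)` within the range of the chain.
  have hleft : ∀ z ∈ Q, W.vertex s p < W.cross (s p) z := fun z hz =>
    (W.wire_lt_iff (memQ.1 hz).2.2.1).1 ((memQ.1 hz).2.1 p (by omega))
  have hright : ∀ z ∈ Q, W.cross z (s (q + 1)) < W.vertex s q := fun z hz =>
    (W.wire_gt_iff (memQ.1 hz).2.2.2.1).1 ((memQ.1 hz).2.1.wire_lt_right hc (by omega))
  -- Between these crossings they stay above `s (p + 1)` and `s q`.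
  have habove_a : ∀ z ∈ Q, ∀ t, W.cross (s p) z ≤ t → t ≤ W.cross z (s (q + 1)) →
      W.wire (s (p + 1)) t < W.wire z t := by
    intro z hz t ht1 ht2
    obtain ⟨hzo, hza, hpz, hzq, hzX⟩ := memQ.1 hz
    rcases lt_or_gt_of_ne (hzo (p + 1) (by omega)) with h | h
    · have := (W.wire_gt_iff h).1 (hza.wire_lt_right hc (show p ≤ m by omega))
      exact (W.wire_gt_iff h).2 (by linarith [hleft z hz])
    -- Minimality for the shorter pair makes this triple an inversion, so `z` meets `s (q + 1)`
    -- before `s (p + 1)`.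
    · have := hW.order_of_mem h hzq (hminimal (p + 1) (q + 1) (by omega) hq (by omega) z hzo hza
        h hzq)
      exact (W.wire_lt_iff h).2 (by linarith)
  have habove_b : ∀ z ∈ Q, ∀ t, W.cross (s p) z ≤ t → t ≤ W.cross z (s (q + 1)) →
      W.wire (s q) t < W.wire z t := by
    intro z hz t ht1 ht2
    obtain ⟨hzo, hza, hpz, hzq, hzX⟩ := memQ.1 hz
    rcases lt_or_gt_of_ne (hzo q (by omega)) with h | h
    · have := hW.order_of_mem hpz h (hminimal p q (by omega) (by omega) (by omega) z hzo hza
        hpz h)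
      exact (W.wire_gt_iff h).2 (by linarith)
    · have := (W.wire_lt_iff h).1 (hza q (by omega))
      exact (W.wire_lt_iff h).2 (by linarith [hright z hz])
  set Z : Finset (Fin n) := insert (s p) (insert (s (q + 1)) Q) with hZ
  have memZ : ∀ {z}, z ∈ Z ↔ z = s p ∨ z = s (q + 1) ∨ z ∈ Q := by simp [hZ]
  have hpZ : s p ∈ Z := memZ.2 (Or.inl rfl)
  have hqZ : s (q + 1) ∈ Z := memZ.2 (Or.inr (Or.inl rfl))
  have hmin : ∀ z ∈ Z, s p ≤ z := by
    intro z hz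
    rcases memZ.1 hz with rfl | rfl | h
    · exact le_rfl
    · exact hik.le
    · exact (memQ.1 h).2.2.1.le
  have hmax : ∀ z ∈ Z, z ≤ s (q + 1) := by
    intro z hz
    rcases memZ.1 hz with rfl | rfl | h
    · exact hik.le
    · exact le_rfl
    · exact (memQ.1 h).2.2.2.1.le
  have hinner : ∀ z ∈ Z, s p < z → z < s (q + 1) → z ∈ Q := by
    intro z hz h1 h2
    rcases memZ.1 hz with rfl | rfl | h
    · exact absurd h1 (lt_irrefl _)
    · exact absurd h2 (lt_irrefl _)
    · exact h
  obtain ⟨u, v, w, huv, hvw, hlt, hel, hN⟩ := hW.exists_envelope_triple hY.2 hpZ hqZ hmin hmax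
    (memZ.2 (Or.inr (Or.inr (memQ.2 ⟨hx, ha, hpx, hxq, hX⟩)))) hpx hxq hX
    (fun z hz h1 h2 h => h.2 (by
      obtain ⟨hzo, hza, -⟩ := memQ.1 (hinner z hz h1 h2)
      exact hc.mem_of_isAbove_of_isClosedFamily hW hY.1 hXY hcY hzo hza hpq hq h1 h2))
  have hpv : s p < v := (hmin u huv.left_mem).trans_lt huv.lt
  have hvq : v < s (q + 1) := hvw.lt.trans_le (hmax w hvw.right_mem)
  have hvQ : v ∈ Q := hinner v hvw.left_mem hpv hvq
  have hc1 : W.cross (s p) v ≤ W.cross u v := by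
    rw [← W.wire_ge_iff hpv, ← W.wire_cross huv.lt.ne]
    exact huv.le _ hpZ
  have hc2 : W.cross v w ≤ W.cross v (s (q + 1)) := by
    rw [← W.wire_le_iff hvq]
    exact hvw.le _ hqZ
  have hl := hleft v hvQ
  have hr := hright v hvQ
  have hYuvw : {u, v, w} ∈ Y := by
    by_contra h
    exact hN ⟨triple_mem_levelSets huv.lt.ne (huv.lt.trans hvw.lt).ne hvw.lt.ne, h⟩
  have hXuvw : {u, v, w} ∉ W.inversionSet := fun h => by
    have := hW.order_of_mem huv.lt hvw.lt h
    linarith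
  refine ⟨u, v, w, huv.lt, hvw.lt, hYuvw, hXuvw, hlt, fun r hrv h1 h2 => ?_, by linarith,
    by rw [Nat.add_sub_cancel]; linarith,
    fun t ht => habove_a v hvQ t (hc1.trans ht.1) (ht.2.trans hc2)⟩
  -- A wire `r` through the floor is there below `s p` and `s (q + 1)` but above `s (p + 1)` and `s
  -- q`. If above the chain, it belongs to `Q` and contradicts consecutiveness on the envelope; if
  -- below, it stays under `s (p + 1)` throughout this range; on the chain, the order of crossings
  -- forbids it.
  set t := W.cross v r with ht
  have hrt : W.wire v t = W.wire r t := W.wire_cross hrv.symm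
  have hva := habove_a v hvQ t (by linarith) (by linarith)
  have hvb := habove_b v hvQ t (by linarith) (by linarith)
  have hvi : W.wire v t < W.wire (s p) t := (W.wire_gt_iff hpv).2 (by linarith)
  have hvk : W.wire v t < W.wire (s (q + 1)) t := (W.wire_lt_iff hvq).2 (by linarith)
  rw [hrt] at hva hvb hvi hvk
  have hq1 : W.vertex s q = W.cross (s q) (s (q + 1)) := rfl
  have hp1 : W.vertex s p = W.cross (s p) (s (p + 1)) := rfl
  by_cases hro : IsOutside m s r
  · rcases hc.isAbove_or_isBelow hW hro with hra | hrb
    · have h3 := W.lt_of_wire_lt (hra p (by omega)) hvi (by linarith)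
      have h4 := W.lt_of_wire_lt hvk (hra.wire_lt_right hc (show q ≤ m by omega)) (by linarith)
      refine hel r (memZ.2 (Or.inr (Or.inr (memQ.2 ⟨hro, hra, h3.1, h4.1, fun h => ?_⟩)))) hrv h1 h2
      have := hW.order_of_mem h3.1 h4.1 h
      linarith [h3.2.2, h4.2.1]
    · have := W.wire_lt_of_between (hrb.wire_lt hc hW (show p ≤ m by omega)
        (show p + 1 < m + 2 by omega)) (hrb.wire_lt hc hW (show q ≤ m by omega)
        (show p + 1 < m + 2 by omega)) (t := t) (by linarith) (by linarith)
      exact this.asymm hva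
  · simp only [IsOutside, not_forall, not_not] at hro
    obtain ⟨l, hl', rfl⟩ := hro
    rcases lt_trichotomy l p with h | rfl | h
    · have := hc.cross_order hW h (Nat.lt_succ_self p) (by omega)
      exact hvi.asymm ((W.wire_gt_iff (hc.lt h (by omega))).2 (by linarith))
    · exact lt_irrefl _ hvi
    rcases lt_trichotomy l (q + 1) with h' | rfl | h'
    · rcases (show p + 1 ≤ l from h).eq_or_lt with rfl | hal
      · exact lt_irrefl _ hva
      rcases (show l ≤ q by omega).eq_or_lt with rfl | hlb
      · exact lt_irrefl _ hvb
      have := hc.cross_order hW hal hlb (by omega)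
      have h3 := (W.wire_lt_iff (hc.lt hal (by omega))).1 hva
      have h4 := (W.wire_gt_iff (hc.lt hlb (by omega))).1 hvb
      linarith
    · exact lt_irrefl _ hvk
    · have := hc.cross_order hW (Nat.lt_succ_self q) h' hl'
      exact hvk.asymm ((W.wire_lt_iff (hc.lt h' hl')).2 (by linarith))

/-- If a wire above a chain of triples of `Y` enters the region between the chain and two of its
wires, then there is a non-inversion triple in `Y` with an elementary floor that is higher than all
floors of the chain. -/
theorem IsChain.exists_higher_triple (hc : W.IsChain m s) (hW : W.IsSimple)
    {Y : Set (Finset (Fin n))} (hY : IsConsistent 2 Y) (hXY : W.inversionSet ⊆ Y)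
    (hcY : ∀ p q r, p < q → q < r → r < m + 2 → {s p, s q, s r} ∈ Y)
    (hx : IsOutside m s x) (ha : W.IsAbove m s x) (hpq : p < q) (hq : q < m + 2)
    (hpx : s p < x) (hxq : x < s q) (hX : {s p, x, s q} ∉ W.inversionSet) :
    ∃ u v w, u < v ∧ v < w ∧ {u, v, w} ∈ Y ∧ {u, v, w} ∉ W.inversionSet ∧
      W.HasElementaryFloor {u, v, w} ∧
      ∀ l < m, W.height {s l, s (l + 1), s (l + 2)} < W.height {u, v, w} := by
  induction hd : q - p using Nat.strong_induction_on generalizing p q x with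
  | _ d ih =>
  by_cases hminimal : ∀ p' q', p' < q' → q' < m + 2 → q' - p' < q - p → ∀ x, IsOutside m s x →
      W.IsAbove m s x → s p' < x → x < s q' → {s p', x, s q'} ∈ W.inversionSet
  swap
  · push Not at hminimal
    obtain ⟨p', q', hpq', hq', hlt, x', hx', ha', h1, h2, h3⟩ := hminimal
    exact ih (q' - p') (by omega) hx' ha' hpq' hq' h1 h2 h3 rfl
  obtain ⟨u, v, w, huv, hvw, hYT, hXT, hlt, hel, hp, hq', habove⟩ :=
    hc.exists_elementary_triple hW hY hXY hcY hx ha hpq hq hpx hxq hX hminimal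
  refine ⟨u, v, w, huv, hvw, hYT, hXT, (hasElementaryFloor_iff huv hvw hlt.le).2 hel,
    fun l hl => ?_⟩
  have hord := hc.cross_order hW (Nat.lt_succ_self l) (Nat.lt_succ_self (l + 1)) (by omega)
  have hlt' := hord.1.trans hord.2
  rw [height_triple huv hvw hlt.le, height_triple (hc.lt (by omega) (by omega))
    (hc.lt (by omega) (by omega)) hlt'.le]
  -- Wires under a floor of the chain are below the whole chain, hence under the new floor. The wire
  -- `s (p + 1)` makes the inclusion strict.
  refine Set.ncard_lt_ncard ⟨fun z hz t ht => ?_, fun hsub => ?_⟩ (Set.toFinite _)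
  · have hzl : W.wire z (W.vertex s l) < W.wire (s l) (W.vertex s l) := by
      rw [hc.wire_vertex (by omega)]
      exact hz _ ⟨le_rfl, hlt'.le⟩
    have hzo : IsOutside m s z := by
      rintro r hr rfl
      exact hzl.not_ge (hc.wire_vertex_le hW (by omega) hr)
    rcases hc.isAbove_or_isBelow hW hzo with hza | hzb
    · exact absurd hzl (hza l (by omega)).asymm
    · exact (W.wire_lt_of_between (hzb.wire_lt hc hW (show p ≤ m by omega)
        (show p + 1 < m + 2 by omega)) (hzb.wire_lt hc hW (show q - 1 ≤ m by omega)
        (show p + 1 < m + 2 by omega)) (hp.trans ht.1) (ht.2.trans hq')).trans (habove t ht)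
  · have h1 := hsub habove (W.vertex s l) ⟨le_rfl, hlt'.le⟩
    rw [← hc.wire_vertex (by omega)] at h1
    exact h1.not_ge (hc.wire_vertex_le hW (by omega) (by omega))

theorem isBlock_singleton {u v w : Fin n} (huv : u < v) (hvw : v < w)
    (h : W.IsNonInversionTriple {u, v, w}) : W.IsBlock {{u, v, w}} := by
  refine ⟨1, ![u, v, w], le_rfl, ?_, ?_, ?_⟩
  · rw [Fin.strictMono_iff_lt_succ]
    intro i
    fin_cases i
    · exact huv
    · exact hvw
  · rw [Set.range_unique]
    rfl
  · rintro T rfl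
    exact h

/-- A block with an elementary floor is the family of triples of consecutive elements of a chain. -/
theorem IsBlock.exists_isChain {𝓘 : Set (Finset (Fin n))} (h : W.IsBlock 𝓘) (hW : W.IsSimple)
    (hfloor : W.HasElementaryBlockFloor 𝓘) :
    ∃ m s, 1 ≤ m ∧ W.IsChain m s ∧ 𝓘 = {T | ∃ l < m, T = {s l, s (l + 1), s (l + 2)}} := by
  obtain ⟨m, a, hm, ha, hI, hnon⟩ := h
  -- The sequence is continued by its last value; chain conditions involve only indices below `m +
  -- 2`.
  set s : ℕ → Fin n := fun l => a ⟨min l (m + 1), by omega⟩ with hs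
  have hlt : ∀ p q, p < q → q < m + 2 → s p < s q := by
    intro p q hpq hq
    refine ha ?_
    rw [Fin.lt_def]
    simp only
    omega
  have hI' : 𝓘 = {T | ∃ l < m, T = {s l, s (l + 1), s (l + 2)}} := by
    have hval : ∀ (l : ℕ) (j : Fin (m + 2)), j.val = l → a j = s l := by
      rintro l j rfl
      refine congrArg a (Fin.ext ?_)
      simp only
      omega
    have heq : ∀ j : Fin m, ({a j.castSucc.castSucc, a j.succ.castSucc, a j.succ.succ} :
        Finset (Fin n)) = {s j, s (j + 1), s (j + 2)} := fun j => by
      rw [hval j j.castSucc.castSucc rfl, hval (j + 1) j.succ.castSucc rfl,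
        hval (j + 2) j.succ.succ rfl]
    rw [hI]
    ext T
    constructor
    · rintro ⟨j, rfl⟩
      exact ⟨j, j.2, heq j⟩
    · rintro ⟨l, hl, rfl⟩
      exact ⟨⟨l, hl⟩, heq ⟨l, hl⟩⟩
  have hX : ∀ p q r, p < q → q < r → r < m + 2 → {s p, s q, s r} ∉ W.inversionSet := by
    intro p q r hpq hqr hr
    refine (IsClosedFamily.mem_of_consecutive hW.isConsistent_inversionSet.2 hlt
      (fun l hl => ?_) hpq hqr hr).2
    have h1 := hlt l (l + 1) (by omega) (by omega)
    have h2 := hlt (l + 1) (l + 2) (by omega) (by omega)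
    refine ⟨triple_mem_levelSets h1.ne (h1.trans h2).ne h2.ne, (hnon _ ?_).notMem⟩
    rw [hI']
    exact ⟨l, hl, rfl⟩
  refine ⟨m, s, hm, ⟨hlt _ _, hX _ _ _, fun l hl => ?_⟩, hI'⟩
  have h1 := hlt l (l + 1) (by omega) (by omega)
  have h2 := hlt (l + 1) (l + 2) (by omega) (by omega)
  have hord := hW.order_of_notMem h1 h2 (hX _ _ _ (by omega) (by omega) (by omega))
  exact (hasElementaryFloor_iff h1 h2 (hord.1.trans hord.2).le).1
    (hfloor _ (by rw [hI']; exact ⟨l, hl, rfl⟩))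

/-- A highest block with an elementary floor in `Y \ W.inversionSet` can be flipped. -/
theorem IsSimple.union_closureFamily_mem (hW : W.IsSimple)
    (Y : Set (Finset (Fin n))) (hY : Y ∈ B n 2) (hXY : W.inversionSet ⊆ Y)
    (𝓘 : Set (Finset (Fin n))) (hblock : W.IsBlock 𝓘) (hsub : 𝓘 ⊆ Y \ W.inversionSet)
    (hfloor : W.HasElementaryBlockFloor 𝓘)
    (hmax : ∀ 𝓙 : Set (Finset (Fin n)), W.IsBlock 𝓙 → 𝓙 ⊆ Y \ W.inversionSet →
      W.HasElementaryBlockFloor 𝓙 → W.blockHeight 𝓙 ≤ W.blockHeight 𝓘) :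
    W.inversionSet ∪ closureFamily 2 𝓘 ∈ B n 2 := by
  obtain ⟨m, s, hm, hc, rfl⟩ := hblock.exists_isChain hW hfloor
  rw [closureFamily_consecutive fun p q => hc.lt]
  refine hc.isConsistent_union hW fun x hx ha p q hpq hq hpx hxq => ?_
  rw [triple_swap]
  by_contra hX
  obtain ⟨u, v, w, huv, hvw, hYT, hXT, hel, hheight⟩ := hc.exists_higher_triple hW hY hXY
    (fun p q r => IsClosedFamily.mem_of_consecutive hY.1 (fun p q => hc.lt)
      fun l hl => (hsub ⟨l, hl, rfl⟩).1) hx ha hpq hq hpx hxq hX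
  have hle := hmax {{u, v, w}} (isBlock_singleton huv hvw (hW.isNonInversionTriple huv hvw hXT))
    (singleton_subset_iff.2 ⟨hYT, hXT⟩) (by rintro T rfl; exact hel)
  rw [blockHeight, image_singleton, csSup_singleton] at hle
  refine hle.not_gt ?_
  -- The supremum is attained by some triple of the block, so equality of all heights in the block
  -- is not needed.
  obtain ⟨T, ⟨l, hl, rfl⟩, hT⟩ := Nat.sSup_mem
    (s := W.height '' {T | ∃ l < m, T = {s l, s (l + 1), s (l + 2)}})
    ⟨_, mem_image_of_mem _ ⟨0, by omega, rfl⟩⟩ (Set.toFinite _).bddAbove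
  rw [blockHeight, ← hT]
  exact hheight l hl

end WiringDiagram
end HigherBruhat

theorem mainTheorem3 (n : ℕ) (W : HigherBruhat.WiringDiagram n) (hW : W.IsSimple)
    (Y : Set (Finset (Fin n))) (hY : Y ∈ HigherBruhat.B n 2) (hXY : W.inversionSet ⊆ Y)
    (𝓘 : Set (Finset (Fin n))) (hblock : W.IsBlock 𝓘) (hsub : 𝓘 ⊆ Y \ W.inversionSet)
    (hfloor : W.HasElementaryBlockFloor 𝓘)
    (hmax : ∀ 𝓙 : Set (Finset (Fin n)), W.IsBlock 𝓙 → 𝓙 ⊆ Y \ W.inversionSet →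
      W.HasElementaryBlockFloor 𝓙 → W.blockHeight 𝓙 ≤ W.blockHeight 𝓘) :
    W.inversionSet ∪ HigherBruhat.closureFamily 2 𝓘 ∈ HigherBruhat.B n 2 :=
  hW.union_closureFamily_mem Y hY hXY 𝓘 hblock hsub hfloor hmax
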